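/- **Model.** A base station with $N$ antennas (half-wavelength uniform linear array, wavelength $\lambda=c/f_c$, spacing $d=\lambda/2$; $f_c,B_w,c>0$), $M$ RF chains and $P$ sub-carriers $f_p=f_c+\frac{2p-P}{2P}B_w$, $p=1,\dots,P$, receives $T$ pilot symbols $s_k[t]$ from each of $K$ single-antenna users over line-of-sight channels $$h_{p,k}=\alpha_k e^{-j2\pi f_p\tau_k}\,b(\theta_k,r_k),\qquad b(\theta,r)_n=\tfrac1{\sqrt N}e^{-j\frac{2\pi}{\lambda}(r^{(n)}-r)},\qquad r^{(n)}=\sqrt{r^2+(n-1)^2d^2-2r(n-1)d\sin\theta}.$$ The combining matrix $W=[w_1\cdots w_M]\in\mathbb C^{N\times M}$ has entries $W_{nm}=e^{j\Phi_{mn}}$ with $\Phi_{mn}$ independent and uniform on $(0,2\pi)$. The noiseless received tensor $\mathcal Y\in\mathbb C^{P\times M\times T}$ has entries $y_{p,m}[t]=w_m^H\sum_k h_{p,k}s_k[t]$. Put $$(G_o)_{pk}=e^{-j2\pi f_p\tau_k},\qquad A_o=W^HBD_\alpha,\qquad (S_o)_{tk}=s_k[t],$$ where $B=[b(\theta_1,r_1)\cdots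 b(\theta_K,r_K)]$ and $D_\alpha=\mathrm{diag}(\alpha_1,\dots,\alpha_K)$. The k-rank $k_X$ of a matrix $X$ is the largest $k$, at most the number of columns, such that any $k$ columns of $X$ are linearly independent. Let the angles and distances $(\theta_k,r_k)_{k\le K}$, with $r_k>0$, be fixed or random, and independent of $(\Phi_{mn})$. **Theorem.** (1) If $K\le N$ and the joint law of $(\theta_1,\dots,\theta_K,r_1,\dots,r_K)$ is absolutely continuous with respect to Lebesgue measure on $\mathbb R^{2K}$, then with probability one $B$ has full column rank $K$ and the conclusion $(\ast)$ below holds. (2) For arbitrary (also deterministic) angles and distances, with probability one: if $B$ has full column rank $K$, then $(\ast)$ holds. $(\ast)$ For every $P$, all nonzero gains $\alpha_1,\dots,\alpha_K\in\mathbb C$ and all delays $\tau_1,\dots,\tau_K\in\mathbb R$ that are pairwise distinct modulo $P/B_w$, $$k_{G_o}=\min(P,K),\qquad k_{A_o}=\min(M,K).$$ If moreover $P\ge K$, $M\ge K$, $K\ge2$, $T\ge2$ and the pilot vectors $s_k=(s_k[1],\dots,s_k[T])^T$ of the users are pairwise linearly independent, then $k_{G_o}=k_{A_o}=K$, Kruskal's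 condition $$k_{G_o}+k_{A_o}+k_{S_o}\ge 2K+2$$ holds, $\mathcal Y$ has tensor rank exactly $K$, $\mathcal Y=\sum_{k=1}^K g_k\circ a_k\circ s_k$ with $g_k,a_k,s_k$ the columns of $G_o,A_o,S_o$, and this decomposition is essentially unique: whenever $(\bar G,\bar A,\bar S)$ also decomposes $\mathcal Y$ into $K$ terms, there are a unique permutation matrix $\Pi$ and unique diagonal matrices $\Lambda_1,\Lambda_2,\Lambda_3$ with $\Lambda_1\Lambda_2\Lambda_3=I_K$ such that $\bar G=G_o\Lambda_1\Pi$, $\bar A=A_o\Lambda_2\Pi$, $\bar S=S_o\Lambda_3\Pi$. -/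

import Mathlib

open MeasureTheory ProbabilityTheory
open scoped Matrix

noncomputable section

/-! ## Factor matrices, k-rank and essential uniqueness -/

/-- The k-rank of a matrix with `n` columns: the largest `k ≤ n` such that any `k` columns are
linearly independent. -/
def kRank {m n : ℕ} (A : Matrix (Fin m) (Fin n) ℂ) : ℕ :=
  sSup {k : ℕ | k ≤ n ∧ ∀ s : Finset (Fin n), s.card = k →
    LinearIndependent ℂ (fun j : s => A.col (j : Fin n))}

/-- The third-order tensor `∑ q, a_q ∘ b_q ∘ c_q`, where `a_q, b_q, c_q` are the columns of the
factor matrices. -/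
def cpTensor {I₁ I₂ I₃ Q : ℕ} (A : Matrix (Fin I₁) (Fin Q) ℂ) (B : Matrix (Fin I₂) (Fin Q) ℂ)
    (C : Matrix (Fin I₃) (Fin Q) ℂ) : Fin I₁ → Fin I₂ → Fin I₃ → ℂ :=
  fun i j l => ∑ q, A i q * B j q * C l q

/-- `R` is the tensor rank of `Y`: the least number of rank-one terms that sum to `Y`. -/
def HasTensorRank {I₁ I₂ I₃ : ℕ} (Y : Fin I₁ → Fin I₂ → Fin I₃ → ℂ) (R : ℕ) : Prop :=
  IsLeast {Q : ℕ | ∃ (A : Matrix (Fin I₁) (Fin Q) ℂ) (B : Matrix (Fin I₂) (Fin Q) ℂ)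
    (C : Matrix (Fin I₃) (Fin Q) ℂ), Y = cpTensor A B C} R

/-- `(A, B, C)` decomposes `Y` into `Q` terms, and it is the only such decomposition up to scaling
and permutation: every other one is `(A Λ_A Π, B Λ_B Π, C Λ_C Π)` for a unique permutation
matrix `Π` and unique diagonal matrices with `Λ_A Λ_B Λ_C = 1`. The permutation and the three
diagonals are the components of `x`. -/
def IsEssentiallyUniqueCPD {I₁ I₂ I₃ Q : ℕ} (Y : Fin I₁ → Fin I₂ → Fin I₃ → ℂ)
    (A : Matrix (Fin I₁) (Fin Q) ℂ) (B : Matrix (Fin I₂) (Fin Q) ℂ)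
    (C : Matrix (Fin I₃) (Fin Q) ℂ) : Prop :=
  Y = cpTensor A B C ∧
  ∀ (A' : Matrix (Fin I₁) (Fin Q) ℂ) (B' : Matrix (Fin I₂) (Fin Q) ℂ)
    (C' : Matrix (Fin I₃) (Fin Q) ℂ), Y = cpTensor A' B' C' →
    ∃! x : Equiv.Perm (Fin Q) × (Fin Q → ℂ) × (Fin Q → ℂ) × (Fin Q → ℂ),
      Matrix.diagonal x.2.1 * Matrix.diagonal x.2.2.1 * Matrix.diagonal x.2.2.2 = 1 ∧
      A' = A * Matrix.diagonal x.2.1 * x.1.permMatrix ℂ ∧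
      B' = B * Matrix.diagonal x.2.2.1 * x.1.permMatrix ℂ ∧
      C' = C * Matrix.diagonal x.2.2.2 * x.1.permMatrix ℂ

/-! ## The line-of-sight signal model

`fc` is the carrier frequency, `Bw` the bandwidth, `c` the speed of light. Sub-carriers and
antennas are numbered from `0` here, from `1` in the usual formulas. -/

/-- Frequency `f_p = f_c + (2p - P) / (2P) · Bw` of the `p`-th sub-carrier, `p = 1, …, P`. -/
def subcarrierFreq (fc Bw : ℝ) (P : ℕ) (p : Fin P) : ℝ :=
  fc + (2 * ((p : ℝ) + 1) - P) / (2 * P) * Bw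

/-- Distance from the `(n+1)`-th antenna of a uniform linear array with spacing `d` to the point
with angle `θ` and distance `r` seen from the first antenna. -/
def antennaDist (d θ r : ℝ) (n : ℕ) : ℝ :=
  Real.sqrt (r ^ 2 + (n : ℝ) ^ 2 * d ^ 2 - 2 * r * n * d * Real.sin θ)

/-- Spherical-wave (near-field) steering vector of the half-wavelength array with `N` antennas, at
wavelength `lam`. -/
def steeringVec (N : ℕ) (lam θ r : ℝ) : Fin N → ℂ := fun n =>
  ((1 / Real.sqrt N : ℝ) : ℂ) *
    Complex.exp (-(Complex.I * ((2 * Real.pi / lam * (antennaDist (lam / 2) θ r n - r) : ℝ) : ℂ)))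

/-- The array response matrix `B`, whose columns are the users' steering vectors; the wavelength
is `c / fc`. -/
def steeringMat (N : ℕ) {K : ℕ} (fc c : ℝ) (θ r : Fin K → ℝ) : Matrix (Fin N) (Fin K) ℂ :=
  Matrix.of fun n k => steeringVec N (c / fc) (θ k) (r k) n

/-- Phase-only combining matrix `W`, with entries `exp (j φ_{m n})` in row `n`, column `m`. -/
def combiner {M N : ℕ} (φ : Fin M → Fin N → ℝ) : Matrix (Fin N) (Fin M) ℂ :=
  Matrix.of fun n m => Complex.exp (Complex.I * (φ m n : ℂ))

/-- Phase response `exp (-j 2π f_p τ)` of a path with delay `τ` on the `p`-th sub-carrier. -/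
def delayResponse (fc Bw : ℝ) (P : ℕ) (τ : ℝ) (p : Fin P) : ℂ :=
  Complex.exp (-(Complex.I * ((2 * Real.pi * subcarrierFreq fc Bw P p * τ : ℝ) : ℂ)))

/-- Line-of-sight channel vector `α e^{-j 2π f_p τ} b(θ, r)` of one user on the `p`-th
sub-carrier. -/
def losChannel (N : ℕ) (fc Bw c : ℝ) (P : ℕ) (α : ℂ) (τ θ r : ℝ) (p : Fin P) : Fin N → ℂ :=
  (α * delayResponse fc Bw P τ p) • steeringVec N (c / fc) θ r

/-- The noiseless received tensor: `y_{p,m}[t] = w_mᴴ ∑ k, h_{p,k} s_k[t]`, where `w_m` is the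
`m`-th column of `W` and `s_k[t] = S t k`. -/
def receivedTensor {N M P T K : ℕ} (fc Bw c : ℝ) (W : Matrix (Fin N) (Fin M) ℂ)
    (α : Fin K → ℂ) (τ θ r : Fin K → ℝ) (S : Matrix (Fin T) (Fin K) ℂ) :
    Fin P → Fin M → Fin T → ℂ :=
  fun p m t => star (W.col m) ⬝ᵥ ∑ k, S t k • losChannel N fc Bw c P (α k) (τ k) (θ k) (r k) p

/-- The factor matrix `G_o`, whose `k`-th column is the delay response of user `k`. -/
def factorG {K : ℕ} (fc Bw : ℝ) (P : ℕ) (τ : Fin K → ℝ) : Matrix (Fin P) (Fin K) ℂ :=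
  Matrix.of fun p k => delayResponse fc Bw P (τ k) p

/-- The factor matrix `A_o = Wᴴ B D_α`. -/
def factorA {N M K : ℕ} (fc c : ℝ) (W : Matrix (Fin N) (Fin M) ℂ) (α : Fin K → ℂ)
    (θ r : Fin K → ℝ) : Matrix (Fin M) (Fin K) ℂ :=
  Wᴴ * steeringMat N fc c θ r * Matrix.diagonal α

/-- Delays that sub-carriers of spacing `Bw / P` can tell apart: distinct modulo `P / Bw`. -/
def DistinctDelays {K : ℕ} (Bw : ℝ) (P : ℕ) (τ : Fin K → ℝ) : Prop :=
  ∀ i j, i ≠ j → ∀ n : ℤ, τ i - τ j ≠ n * ((P : ℝ) / Bw)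

/-- The outcome of the uniqueness analysis for one combining matrix `W` and one placement `(θ, r)`
of the users, for all distinct delays, nonzero gains and numbers `P`, `T` of sub-carriers and pilot
symbols: the k-ranks of `G_o` and `A_o`; and, for at least two users with pairwise linearly
independent pilot vectors, `P ≥ K`, `M ≥ K` and `T ≥ 2`, Kruskal's condition, the rank of the
received tensor and the essential uniqueness of its decomposition. -/
def LosUniqueness {N M K : ℕ} (fc Bw c : ℝ) (W : Matrix (Fin N) (Fin M) ℂ)
    (θ r : Fin K → ℝ) : Prop :=
  ∀ (P : ℕ) (τ : Fin K → ℝ) (α : Fin K → ℂ), DistinctDelays Bw P τ → (∀ k, α k ≠ 0) →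
    kRank (factorG fc Bw P τ) = min P K ∧
    kRank (factorA fc c W α θ r) = min M K ∧
    ∀ (T : ℕ) (S : Matrix (Fin T) (Fin K) ℂ), K ≤ P → K ≤ M → 2 ≤ K → 2 ≤ T →
      (Pairwise fun i j => LinearIndependent ℂ ![S.col i, S.col j]) →
      kRank (factorG fc Bw P τ) = K ∧
      kRank (factorA fc c W α θ r) = K ∧
      2 * K + 2 ≤ kRank (factorG fc Bw P τ) + kRank (factorA fc c W α θ r) + kRank S ∧
      HasTensorRank (receivedTensor (P := P) fc Bw c W α τ θ r S) K ∧
      IsEssentiallyUniqueCPD (receivedTensor (P := P) fc Bw c W α τ θ r S)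
        (factorG fc Bw P τ) (factorA fc c W α θ r) S

end

/-!
With `P ≥ K` and `M ≥ K` the two factors `G_o` and `A_o` have full column rank, so the uniqueness
of the decomposition needs only the elementary case of Kruskal's theorem in which contracting the
tensor with vectors `v` yields the matrices `G_o · diag (s_k · v) · A_oᵀ`. Two of these
contractions form a matrix pencil whose generalized eigenvalues `(s_k · v) / (s_k · w)` are
distinct for suitable `v`, `w`, because the pilot vectors are pairwise independent; the
eigenvectors then determine the factors up to order and scaling (`exists_perm_of_cpTensor_eq`,
`isEssentiallyUniqueCPD_of_linearIndependent`).

The k-rank of `G_o` comes from Vandermonde determinants, since phase responses on equally spaced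
sub-carriers are geometric progressions (`kRank_factorG`).

The two random statements rest on `ae_det_ne_zero_of_forall_ae_dotProduct_ne_zero`: a matrix with
independent rows is almost surely nonsingular if each row avoids every fixed hyperplane almost
surely. For the rows of `Wᴴ B` this holds because a combination `∑ d_n e^{-i φ_n}` with `d_n ≠ 0`
vanishes for only countably many values of `φ_n` once the other phases are fixed
(`ae_sum_exp_neg_I_mul_ne_zero`). For steering vectors, fix `r > 0` and put `s = sin θ`. The
squared distances to the antennas are affine in `s` with distinct slopes `-2 r n d`, so a
combination of the phase profiles is real analytic on `s < 1`, and as `s = -x² → -∞` it approaches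
a trigonometric sum in `x` with the distinct frequencies `κ √(2 r n d)`. Such a sum tends to zero
only if it is trivial, whence the combination has countably many zeros
(`eq_zero_of_wavefrontSum_eqOn_zero`, `ae_wavefrontSum_sin_ne_zero`).
-/

/-! ### Uniqueness of decompositions with two factors of full column rank -/

theorem exists_leftInverse_of_linearIndependent_col {m n : ℕ} {A : Matrix (Fin m) (Fin n) ℂ}
    (hA : LinearIndependent ℂ A.col) : ∃ L : Matrix (Fin n) (Fin m) ℂ, L * A = 1 := by
  have hinj : Function.Injective A.mulVecLin := by
    exact Matrix.mulVec_injective_iff.2 hA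
  obtain ⟨g, hg⟩ := A.mulVecLin.exists_leftInverse_of_injective (LinearMap.ker_eq_bot.2 hinj)
  refine ⟨LinearMap.toMatrix' g, ?_⟩
  have h := congrArg LinearMap.toMatrix' hg
  rw [LinearMap.toMatrix'_comp, LinearMap.toMatrix'_id] at h
  rwa [show A.mulVecLin = Matrix.toLin' A from rfl, LinearMap.toMatrix'_toLin'] at h

/-- Contracting the third index of a decomposed tensor with a vector `v` leaves
`A · diag (vᵀ C) · Bᵀ`. -/
theorem contract_cpTensor {I₁ I₂ I₃ Q : ℕ} (A : Matrix (Fin I₁) (Fin Q) ℂ)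
    (B : Matrix (Fin I₂) (Fin Q) ℂ) (C : Matrix (Fin I₃) (Fin Q) ℂ) (v : Fin I₃ → ℂ) :
    (Matrix.of fun i j => ∑ l, v l * cpTensor A B C i j l) =
      A * Matrix.diagonal (v ᵥ* C) * Bᵀ := by
  ext i j
  rw [Matrix.of_apply, Matrix.mul_apply]
  simp only [cpTensor, Matrix.mul_diagonal,
    Matrix.transpose_apply, Matrix.vecMul, dotProduct, Finset.mul_sum, Finset.sum_mul]
  rw [Finset.sum_comm]
  refine Finset.sum_congr rfl fun q _ => Finset.sum_congr rfl fun l _ => by ring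

theorem contract_eq_of_cpTensor_eq {I₁ I₂ I₃ Q R : ℕ} {A : Matrix (Fin I₁) (Fin Q) ℂ}
    {B : Matrix (Fin I₂) (Fin Q) ℂ} {C : Matrix (Fin I₃) (Fin Q) ℂ}
    {A' : Matrix (Fin I₁) (Fin R) ℂ} {B' : Matrix (Fin I₂) (Fin R) ℂ}
    {C' : Matrix (Fin I₃) (Fin R) ℂ} (h : cpTensor A B C = cpTensor A' B' C') (v : Fin I₃ → ℂ) :
    A * Matrix.diagonal (v ᵥ* C) * Bᵀ = A' * Matrix.diagonal (v ᵥ* C') * B'ᵀ := by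
  rw [← contract_cpTensor, ← contract_cpTensor, h]

/-- Left inverses of the two factors of full column rank reduce the equality of two contracted
decompositions to an equality of small matrices. -/
theorem diagonal_eq_of_contract_eq {I₁ I₂ Q R : ℕ} {A : Matrix (Fin I₁) (Fin Q) ℂ}
    {B : Matrix (Fin I₂) (Fin Q) ℂ} {D : Matrix (Fin Q) (Fin Q) ℂ}
    {A' : Matrix (Fin I₁) (Fin R) ℂ} {B' : Matrix (Fin I₂) (Fin R) ℂ}
    {D' : Matrix (Fin R) (Fin R) ℂ} (h : A * D * Bᵀ = A' * D' * B'ᵀ)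
    {LA : Matrix (Fin Q) (Fin I₁) ℂ} {LB : Matrix (Fin Q) (Fin I₂) ℂ}
    (hLA : LA * A = 1) (hLB : LB * B = 1) :
    D = (LA * A') * D' * (LB * B')ᵀ := by
  have hB : Bᵀ * LBᵀ = 1 := by rw [← Matrix.transpose_mul, hLB, Matrix.transpose_one]
  calc D = (LA * A) * D * (Bᵀ * LBᵀ) := by rw [hLA, hB, Matrix.one_mul, Matrix.mul_one]
    _ = LA * (A * D * Bᵀ) * LBᵀ := by simp only [Matrix.mul_assoc]
    _ = _ := by rw [h, Matrix.transpose_mul]; simp only [Matrix.mul_assoc]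

/-- Two decompositions with the same nonsingular contraction have factors with the same column
space, so the second factor is recovered from its coordinates in the first. -/
theorem factor_eq_of_contract_eq {I₁ I₂ Q : ℕ} {A A' : Matrix (Fin I₁) (Fin Q) ℂ}
    {B B' : Matrix (Fin I₂) (Fin Q) ℂ} {D D' : Matrix (Fin Q) (Fin Q) ℂ}
    (h : A * D * Bᵀ = A' * D' * B'ᵀ)
    {LA : Matrix (Fin Q) (Fin I₁) ℂ} {LB : Matrix (Fin Q) (Fin I₂) ℂ}
    (hLA : LA * A = 1) (hLB : LB * B = 1) (hD : IsUnit D.det) :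
    A' = A * (LA * A') := by
  have hd := diagonal_eq_of_contract_eq h hLA hLB
  have hB : Bᵀ * LBᵀ = 1 := by rw [← Matrix.transpose_mul, hLB, Matrix.transpose_one]
  set X := LA * A' with hX
  have h1 : X * (D' * (LB * B')ᵀ * D⁻¹) = 1 := by
    rw [← Matrix.mul_assoc, ← Matrix.mul_assoc, ← hd, Matrix.mul_nonsing_inv _ hD]
  have h2 := mul_eq_one_comm.1 h1
  have h3 : A * D = A' * D' * (LB * B')ᵀ := by
    calc A * D = A * D * (Bᵀ * LBᵀ) := by rw [hB, Matrix.mul_one]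
      _ = (A * D * Bᵀ) * LBᵀ := by simp only [Matrix.mul_assoc]
      _ = _ := by rw [h, Matrix.transpose_mul]; simp only [Matrix.mul_assoc]
  calc A' = A' * (D' * (LB * B')ᵀ * D⁻¹ * X) := by rw [h2, Matrix.mul_one]
    _ = (A' * D' * (LB * B')ᵀ) * D⁻¹ * X := by simp only [Matrix.mul_assoc]
    _ = A * X := by rw [← h3, Matrix.mul_nonsing_inv_cancel_right _ _ hD]

theorem ne_zero_of_pairwise_linearIndependent {m n : ℕ} {C : Matrix (Fin m) (Fin n) ℂ}
    (hn : 2 ≤ n) (hC : Pairwise fun i j => LinearIndependent ℂ ![C.col i, C.col j]) (i : Fin n) :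
    C.col i ≠ 0 := by
  have : Nontrivial (Fin n) := Fin.nontrivial_iff_two_le.2 hn
  obtain ⟨j, hj⟩ := exists_ne i
  simpa using (hC hj.symm).ne_zero 0

/-- A finite family of nonzero vectors is not orthogonal to a suitable vector. -/
theorem exists_forall_dotProduct_ne_zero {ι : Type*} [Finite ι] {m : ℕ} (u : ι → Fin m → ℂ)
    (hu : ∀ i, u i ≠ 0) : ∃ v : Fin m → ℂ, ∀ i, v ⬝ᵥ u i ≠ 0 := by
  obtain ⟨f, hf⟩ := Module.exists_dual_forall_apply_ne_zero (K := ℂ) u hu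
  refine ⟨fun l => f (Pi.single l 1), fun i => ?_⟩
  have := LinearMap.pi_apply_eq_sum_univ f (u i)
  convert! hf i using 1
  rw [this, dotProduct]
  refine Finset.sum_congr rfl fun l _ => ?_
  rw [smul_eq_mul, mul_comm]
  congr 2
  ext j
  simp [Pi.single_apply, eq_comm]

/-- Every decomposition into as many terms agrees with a given one, up to order and scaling, if two
of the given factors have full column rank and the columns of the third are pairwise linearly
independent: contraction turns both decompositions into eigendecompositions of one matrix, whose
eigenvalues are simple for a suitable choice of the contracting vectors. -/
theorem exists_perm_of_cpTensor_eq {I₁ I₂ I₃ Q : ℕ} {A A' : Matrix (Fin I₁) (Fin Q) ℂ}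
    {B B' : Matrix (Fin I₂) (Fin Q) ℂ} {C C' : Matrix (Fin I₃) (Fin Q) ℂ}
    (hA : LinearIndependent ℂ A.col) (hB : LinearIndependent ℂ B.col)
    (hC0 : ∀ i, C.col i ≠ 0)
    (hC : Pairwise fun i j => LinearIndependent ℂ ![C.col i, C.col j])
    (h : cpTensor A B C = cpTensor A' B' C') :
    ∃ (σ : Equiv.Perm (Fin Q)) (x z : Fin Q → ℂ), (∀ j, x j ≠ 0) ∧ (∀ j, z j ≠ 0) ∧
      (∀ i j, A' i j = A i (σ j) * x j) ∧ (∀ i j, B' i j = B i (σ j) * z j) ∧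
      (∀ i j, C' i j = C i (σ j) * (x j * z j)⁻¹) := by
  obtain ⟨LA, hLA⟩ := exists_leftInverse_of_linearIndependent_col hA
  obtain ⟨LB, hLB⟩ := exists_leftInverse_of_linearIndependent_col hB
  obtain ⟨w, hw⟩ := exists_forall_dotProduct_ne_zero (fun i => C.col i) hC0
  -- a second vector `v` separates the ratios `(v · c_i) / (w · c_i)`
  obtain ⟨v, hv⟩ := exists_forall_dotProduct_ne_zero
    (fun p : {p : Fin Q × Fin Q // p.1 ≠ p.2} =>
      (w ⬝ᵥ C.col p.1.2) • C.col p.1.1 - (w ⬝ᵥ C.col p.1.1) • C.col p.1.2) (by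
      rintro ⟨⟨i, j⟩, hij⟩ h0
      have := LinearIndependent.pair_iff.1 (hC hij) (w ⬝ᵥ C.col j) (-(w ⬝ᵥ C.col i)) (by
        simpa [sub_eq_add_neg] using h0)
      exact hw j this.1)
  have hw' : ∀ i, (w ᵥ* C) i ≠ 0 := hw
  have hdet : IsUnit (Matrix.diagonal (w ᵥ* C)).det := by
    rw [Matrix.det_diagonal, isUnit_iff_ne_zero, Finset.prod_ne_zero_iff]
    exact fun i _ => hw' i
  have hcon := contract_eq_of_cpTensor_eq h
  have hAX := factor_eq_of_contract_eq (hcon w) hLA hLB hdet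
  have hBZ : B' = B * (LB * B') := by
    refine factor_eq_of_contract_eq (D := Matrix.diagonal (w ᵥ* C))
      (D' := Matrix.diagonal (w ᵥ* C')) (A := B) (B := A) (B' := A') ?_ hLB hLA hdet
    have := congrArg Matrix.transpose (hcon w)
    simpa [Matrix.transpose_mul, Matrix.mul_assoc] using this
  have hdiag := fun u => diagonal_eq_of_contract_eq (hcon u) hLA hLB
  set X := LA * A'
  set Z := LB * B'
  have hentry : ∀ (u : Fin I₃ → ℂ) (i k : Fin Q),
      ∑ j, X i j * (u ᵥ* C') j * Z k j = if i = k then (u ᵥ* C) i else 0 := by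
    intro u i k
    have := congrFun (congrFun (hdiag u) i) k
    rw [Matrix.diagonal_apply] at this
    rw [this, Matrix.mul_apply]
    simp [Matrix.mul_diagonal]
  have hc' : ∀ j, (w ᵥ* C') j ≠ 0 := by
    have hd := congrArg Matrix.det (hdiag w)
    rw [Matrix.det_mul, Matrix.det_mul, Matrix.det_diagonal (d := w ᵥ* C')] at hd
    intro j hj
    rw [Finset.prod_eq_zero (Finset.mem_univ j) hj] at hd
    exact hdet.ne_zero (by simpa using hd)
  -- `Y` is the inverse of `X`
  set Y : Matrix (Fin Q) (Fin Q) ℂ := Matrix.diagonal (w ᵥ* C') * Zᵀ *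
    (Matrix.diagonal (w ᵥ* C))⁻¹ with hY
  have hXY : X * Y = 1 := by
    rw [hY, ← Matrix.mul_assoc, ← Matrix.mul_assoc, ← hdiag w, Matrix.mul_nonsing_inv _ hdet]
  have hYX : Y * X = 1 := mul_eq_one_comm.1 hXY
  -- the columns of `X` are eigenvectors of the diagonal matrix of ratios
  have heig : ∀ i j, (v ᵥ* C) i / (w ᵥ* C) i * X i j =
      X i j * ((v ᵥ* C') j / (w ᵥ* C') j) := by
    intro i j
    have hZ : ∀ k l, (w ᵥ* C') l * Z k l = Y l k * (w ᵥ* C) k := by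
      intro k l
      have : Y * Matrix.diagonal (w ᵥ* C) = Matrix.diagonal (w ᵥ* C') * Zᵀ := by
        rw [hY, Matrix.nonsing_inv_mul_cancel_right _ _ hdet]
      have := congrFun (congrFun this l) k
      simpa [Matrix.mul_diagonal, Matrix.diagonal_mul] using this.symm
    have h1 : ∀ i k, ∑ l, X i l * ((v ᵥ* C') l / (w ᵥ* C') l) * Y l k =
        if i = k then (v ᵥ* C) i / (w ᵥ* C) i else 0 := by
      intro i k
      have := hentry v i k
      rw [← mul_left_inj' (hw' k), Finset.sum_mul]
      refine (Finset.sum_congr rfl fun l _ => ?_).trans (this.trans ?_)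
      · rw [mul_assoc _ (Y l k), ← hZ]
        field_simp [hc' l]
      · split_ifs with hik
        · subst hik; field_simp [hw' i]
        · simp
    have h2 : Matrix.diagonal (fun i => (v ᵥ* C) i / (w ᵥ* C) i) =
        X * Matrix.diagonal (fun j => (v ᵥ* C') j / (w ᵥ* C') j) * Y := by
      ext i k
      rw [Matrix.diagonal_apply, ← h1, Matrix.mul_apply]
      simp [Matrix.mul_diagonal]
    have h3 : Matrix.diagonal (fun i => (v ᵥ* C) i / (w ᵥ* C) i) * X =
        X * Matrix.diagonal (fun j => (v ᵥ* C') j / (w ᵥ* C') j) := by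
      rw [h2, Matrix.mul_assoc, hYX, Matrix.mul_one]
    have := congrFun (congrFun h3 i) j
    simpa [Matrix.mul_diagonal, Matrix.diagonal_mul] using this
  have hsep : ∀ i k, (v ᵥ* C) i / (w ᵥ* C) i = (v ᵥ* C) k / (w ᵥ* C) k → i = k := by
    intro i k hik
    by_contra hne
    refine hv ⟨(i, k), hne⟩ ?_
    rw [div_eq_div_iff (hw' i) (hw' k)] at hik
    simp only [dotProduct_sub, dotProduct_smul, smul_eq_mul]
    have h1 : ∀ (u : Fin I₃ → ℂ) k, u ⬝ᵥ C.col k = (u ᵥ* C) k := fun _ _ => rfl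
    rw [h1, h1, h1, h1, sub_eq_zero, mul_comm, hik, mul_comm]
  have hcol : ∀ j, ∃ i, X i j ≠ 0 := by
    intro j
    by_contra! h0
    have := congrFun (congrFun hYX j) j
    simp [Matrix.mul_apply, h0] at this
  choose s hs using hcol
  have huniq : ∀ i j, X i j ≠ 0 → i = s j := by
    intro i j hij
    refine hsep _ _ ?_
    have h1 := heig i j
    have h2 := heig (s j) j
    rw [mul_comm (X i j)] at h1
    rw [mul_comm (X (s j) j)] at h2
    rw [mul_right_cancel₀ hij h1, mul_right_cancel₀ (hs j) h2]
  have hsurj : Function.Surjective s := by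
    intro i
    by_contra! h0
    have := congrFun (congrFun hXY i) i
    rw [Matrix.mul_apply, Finset.sum_eq_zero] at this
    · simp at this
    · intro j _
      rw [show X i j = 0 from by
        by_contra hx
        exact h0 j (huniq i j hx).symm, zero_mul]
  have hinj : Function.Injective s := Finite.injective_iff_surjective.2 hsurj
  have hX0 : ∀ i j, i ≠ s j → X i j = 0 := fun i j hij => by
    by_contra hx
    exact hij (huniq i j hx)
  have hmono : ∀ (u : Fin I₃ → ℂ) (j k : Fin Q),
      X (s j) j * (u ᵥ* C') j * Z k j = if s j = k then (u ᵥ* C) (s j) else 0 := by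
    intro u j k
    rw [← hentry u (s j) k, Finset.sum_eq_single j]
    · intro l _ hl
      rw [hX0 _ _ fun e => hl (hinj e).symm]
      ring
    · simp
  have hZ0 : ∀ k j, k ≠ s j → Z k j = 0 := by
    intro k j hkj
    have := hmono w j k
    rw [if_neg hkj.symm] at this
    simpa [hs j, hc' j] using this
  have hZs : ∀ j, Z (s j) j ≠ 0 := by
    intro j h0
    have := hmono w j (s j)
    rw [if_pos rfl, h0, mul_zero] at this
    exact hw' _ this.symm
  refine ⟨Equiv.ofBijective s ⟨hinj, hsurj⟩, fun j => X (s j) j, fun j => Z (s j) j, hs, hZs,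
    ?_, ?_, ?_⟩
  · intro i j
    conv_lhs => rw [hAX, Matrix.mul_apply]
    exact Finset.sum_eq_single (s j) (fun k _ hk => by rw [hX0 k j hk, mul_zero]) (by simp)
  · intro i j
    conv_lhs => rw [hBZ, Matrix.mul_apply]
    exact Finset.sum_eq_single (s j) (fun k _ hk => by rw [hZ0 k j hk, mul_zero]) (by simp)
  · intro i j
    have := hmono (Pi.single i 1) j (s j)
    rw [if_pos rfl, Matrix.single_one_vecMul, Matrix.single_one_vecMul] at this
    change X (s j) j * C' i j * Z (s j) j = C i (s j) at this
    change C' i j = C i (s j) * (X (s j) j * Z (s j) j)⁻¹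
    rw [← div_eq_mul_inv, eq_div_iff (mul_ne_zero (hs j) (hZs j)), ← this]
    ring

theorem mul_diagonal_mul_permMatrix_apply {m n : ℕ} (A : Matrix (Fin m) (Fin n) ℂ)
    (d : Fin n → ℂ) (π : Equiv.Perm (Fin n)) (i : Fin m) (j : Fin n) :
    (A * Matrix.diagonal d * π.permMatrix ℂ) i j = A i (π.symm j) * d (π.symm j) := by
  have := congrFun (Matrix.vecMul_permMatrix (R := ℂ) π (v := (A * Matrix.diagonal d) i)) j
  rw [← Matrix.mul_apply_eq_vecMul] at this
  rw [this]
  simp [Matrix.mul_diagonal]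

/-- Full column rank of two factors also fixes the permutation and the scalings: distinct columns
are not proportional. -/
theorem isEssentiallyUniqueCPD_of_linearIndependent {I₁ I₂ I₃ Q : ℕ}
    {A : Matrix (Fin I₁) (Fin Q) ℂ} {B : Matrix (Fin I₂) (Fin Q) ℂ} {C : Matrix (Fin I₃) (Fin Q) ℂ}
    (hA : LinearIndependent ℂ A.col) (hB : LinearIndependent ℂ B.col) (hC0 : ∀ i, C.col i ≠ 0)
    (hC : Pairwise fun i j => LinearIndependent ℂ ![C.col i, C.col j]) :
    IsEssentiallyUniqueCPD (cpTensor A B C) A B C := by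
  refine ⟨rfl, fun A' B' C' h => ?_⟩
  obtain ⟨σ, x, z, hx, hz, hA', hB', hC'⟩ := exists_perm_of_cpTensor_eq hA hB hC0 hC h
  refine ⟨(σ.symm, x ∘ σ.symm, z ∘ σ.symm, fun k => (x (σ.symm k) * z (σ.symm k))⁻¹),
    ⟨?_, ?_, ?_, ?_⟩, ?_⟩
  · rw [Matrix.diagonal_mul_diagonal, Matrix.diagonal_mul_diagonal, ← Matrix.diagonal_one]
    congr 1
    ext k
    exact mul_inv_cancel₀ (mul_ne_zero (hx _) (hz _))
  · ext i j; rw [mul_diagonal_mul_permMatrix_apply, hA']; simp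
  · ext i j; rw [mul_diagonal_mul_permMatrix_apply, hB']; simp
  · ext i j; rw [mul_diagonal_mul_permMatrix_apply, hC']; simp
  · rintro ⟨π, a, b, c⟩ ⟨h1, h2, h3, h4⟩
    -- a column of `A` that is a multiple of another one, with a nonzero factor, is that column
    have hAj : ∀ j, A.col (σ j) = A.col (π.symm j) ∧ a (π.symm j) = x j := by
      intro j
      have hcol : x j • A.col (σ j) = a (π.symm j) • A.col (π.symm j) := by
        ext i
        have := congrFun (congrFun h2 i) j
        rw [mul_diagonal_mul_permMatrix_apply, hA'] at this
        simpa [mul_comm] using this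
      have hidx : σ j = π.symm j := by
        by_contra hne
        have h5 := (LinearIndepOn.pair_iff (R := ℂ) A.col hne).1
          (hA.comp _ Subtype.val_injective) (x j) (-a (π.symm j)) (by rw [hcol]; simp)
        exact hx j h5.1
      refine ⟨by rw [hidx], ?_⟩
      rw [hidx, ← sub_eq_zero, ← sub_smul, smul_eq_zero] at hcol
      exact (sub_eq_zero.1 (hcol.resolve_right (hA.ne_zero _))).symm
    have hidx : ∀ j, σ j = π.symm j := fun j => hA.injective (hAj j).1
    have hπ : π = σ.symm := by
      rw [← Equiv.symm_symm π]
      congr 1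
      ext j : 1
      exact (hidx j).symm
    have ha : a = x ∘ σ.symm := by
      ext k
      have := (hAj (σ.symm k)).2
      rw [← hidx] at this
      simpa using this
    have hb : b = z ∘ σ.symm := by
      ext k
      obtain ⟨j, rfl⟩ := σ.surjective k
      have hcol : (z j - b (σ j)) • B.col (σ j) = 0 := by
        ext i
        have := congrFun (congrFun h3 i) j
        rw [mul_diagonal_mul_permMatrix_apply, hB', ← hidx] at this
        simp only [Pi.smul_apply, Matrix.col_apply, smul_eq_mul, Pi.zero_apply]
        linear_combination this
      have := (smul_eq_zero.1 hcol).resolve_right (hB.ne_zero _)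
      simpa using (sub_eq_zero.1 this).symm
    have hc : c = fun k => (x (σ.symm k) * z (σ.symm k))⁻¹ := by
      ext k
      rw [Matrix.diagonal_mul_diagonal, Matrix.diagonal_mul_diagonal, ← Matrix.diagonal_one] at h1
      have := congrFun (Matrix.diagonal_injective h1) k
      subst ha hb
      exact eq_inv_of_mul_eq_one_right this
    rw [hπ, ha, hb, hc]

/-- A suitable contraction of the tensor is a matrix of rank `Q`, while that of a sum of `R` rank-one
terms has rank at most `R`. -/
theorem hasTensorRank_of_linearIndependent {I₁ I₂ I₃ Q : ℕ}
    {A : Matrix (Fin I₁) (Fin Q) ℂ} {B : Matrix (Fin I₂) (Fin Q) ℂ} {C : Matrix (Fin I₃) (Fin Q) ℂ}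
    (hA : LinearIndependent ℂ A.col) (hB : LinearIndependent ℂ B.col) (hC0 : ∀ i, C.col i ≠ 0) :
    HasTensorRank (cpTensor A B C) Q := by
  refine ⟨⟨A, B, C, rfl⟩, ?_⟩
  rintro R ⟨A', B', C', h⟩
  obtain ⟨LA, hLA⟩ := exists_leftInverse_of_linearIndependent_col hA
  obtain ⟨LB, hLB⟩ := exists_leftInverse_of_linearIndependent_col hB
  obtain ⟨w, hw⟩ := exists_forall_dotProduct_ne_zero (fun i => C.col i) hC0
  have hdet : IsUnit (Matrix.diagonal (w ᵥ* C)).det := by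
    rw [Matrix.det_diagonal, isUnit_iff_ne_zero, Finset.prod_ne_zero_iff]
    exact fun i _ => hw i
  have hrank := Matrix.rank_of_isUnit _ ((Matrix.isUnit_iff_isUnit_det _).2 hdet)
  rw [diagonal_eq_of_contract_eq (contract_eq_of_cpTensor_eq h w) hLA hLB, Fintype.card_fin,
    Matrix.mul_assoc] at hrank
  calc Q = _ := hrank.symm
    _ ≤ (LA * A').rank := Matrix.rank_mul_le_left _ _
    _ ≤ R := by simpa using Matrix.rank_le_card_width (LA * A')

/-! ### The k-rank -/

theorem kRank_bddAbove {m n : ℕ} (A : Matrix (Fin m) (Fin n) ℂ) :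
    BddAbove {k : ℕ | k ≤ n ∧ ∀ s : Finset (Fin n), s.card = k →
      LinearIndependent ℂ (fun j : s => A.col (j : Fin n))} :=
  ⟨n, fun _ hk => hk.1⟩

theorem le_kRank {m n k : ℕ} {A : Matrix (Fin m) (Fin n) ℂ} (hk : k ≤ n)
    (h : ∀ s : Finset (Fin n), s.card = k → LinearIndependent ℂ (fun j : s => A.col (j : Fin n))) :
    k ≤ kRank A :=
  le_csSup (kRank_bddAbove A) ⟨hk, h⟩

theorem kRank_eq_min {m n : ℕ} {A : Matrix (Fin m) (Fin n) ℂ}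
    (h : ∀ s : Finset (Fin n), s.card = min m n →
      LinearIndependent ℂ (fun j : s => A.col (j : Fin n))) :
    kRank A = min m n := by
  refine le_antisymm ?_ (le_kRank (min_le_right _ _) h)
  refine csSup_le ⟨_, min_le_right _ _, h⟩ fun k hk => le_min ?_ hk.1
  obtain ⟨s, -, hs⟩ := Finset.exists_subset_card_eq (s := (Finset.univ : Finset (Fin n))) (n := k)
    (by simpa using hk.1)
  simpa [hs] using (hk.2 s hs).fintype_card_le_finrank

/-- A nonvanishing minor in the leading rows certifies the linear independence of the columns. -/
theorem linearIndependent_col_of_det_ne_zero {m n k : ℕ} (A : Matrix (Fin m) (Fin n) ℂ)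
    (ρ : Fin k → Fin m) (s : Finset (Fin n)) (hs : s.card = k)
    (h : (A.submatrix ρ fun j => s.orderEmbOfFin hs j).det ≠ 0) :
    LinearIndependent ℂ (fun j : s => A.col (j : Fin n)) := by
  have h1 := Matrix.linearIndependent_cols_of_det_ne_zero h
  have h2 : LinearIndependent ℂ fun j : Fin k => A.col (s.orderEmbOfFin hs j) :=
    LinearIndependent.of_comp (R := ℂ) (LinearMap.funLeft ℂ ℂ ρ) h1
  exact (linearIndependent_equiv (R := ℂ) (s.orderIsoOfFin hs).toEquiv
    (f := fun j : s => A.col (j : Fin n))).1 h2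

theorem linearIndependent_col_of_kRank_eq {m n : ℕ} {A : Matrix (Fin m) (Fin n) ℂ}
    (h : kRank A = n) : LinearIndependent ℂ A.col := by
  have hmem := Nat.sSup_mem (s := {k : ℕ | k ≤ n ∧ ∀ s : Finset (Fin n), s.card = k →
    LinearIndependent ℂ (fun j : s => A.col (j : Fin n))})
    ⟨0, Nat.zero_le _, fun s hs => by
      rw [Finset.card_eq_zero] at hs
      subst hs
      exact linearIndependent_empty_type⟩ (kRank_bddAbove A)
  have h1 := hmem.2 Finset.univ (by rw [Finset.card_univ, Fintype.card_fin]; exact h.symm)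
  exact (linearIndependent_equiv (Equiv.subtypeUnivEquiv fun x => Finset.mem_univ x)
    (f := A.col)).1 h1

theorem two_le_kRank {m n : ℕ} {C : Matrix (Fin m) (Fin n) ℂ} (hn : 2 ≤ n)
    (hC : Pairwise fun i j => LinearIndependent ℂ ![C.col i, C.col j]) : 2 ≤ kRank C := by
  refine le_kRank hn fun s hs => ?_
  obtain ⟨i, j, hij, rfl⟩ := Finset.card_eq_two.1 hs
  have h1 : LinearIndepOn ℂ C.col {i, j} :=
    (LinearIndepOn.pair_iff _ hij).2 (LinearIndependent.pair_iff.1 (hC hij))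
  rw [← Finset.coe_pair] at h1
  exact h1

/-! ### Rank conditions as nonvanishing determinants -/

theorem rank_eq_card_iff_linearIndependent_col {m n : ℕ} (A : Matrix (Fin m) (Fin n) ℂ) :
    A.rank = n ↔ LinearIndependent ℂ A.col := by
  rw [linearIndependent_iff_card_eq_finrank_span, Matrix.rank_eq_finrank_span_cols,
    Fintype.card_fin, eq_comm]
  rfl

open scoped ComplexOrder in
/-- The Gram determinant turns full column rank into a measurable condition. -/
theorem rank_eq_card_iff_det_gram_ne_zero {m n : ℕ} (A : Matrix (Fin m) (Fin n) ℂ) :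
    A.rank = n ↔ (Aᴴ * A).det ≠ 0 := by
  rw [← Matrix.rank_conjTranspose_mul_self, rank_eq_card_iff_linearIndependent_col,
    Matrix.linearIndependent_cols_iff_isUnit, Matrix.isUnit_iff_isUnit_det, isUnit_iff_ne_zero]

/-! ### Random matrices with independent rows -/

theorem measurable_det {α : Type*} [MeasurableSpace α] {n : ℕ}
    {A : α → Matrix (Fin n) (Fin n) ℂ} (hA : ∀ i j, Measurable fun a => A a i j) :
    Measurable fun a => (A a).det := by
  simp only [Matrix.det_apply']
  exact Finset.measurable_sum _ fun σ _ =>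
    (Finset.measurable_prod _ fun i _ => hA _ _).const_mul _

/-- A square matrix with independent random rows is almost surely nonsingular as soon as no row
lies in a fixed hyperplane with positive probability. Expand the determinant along the first row:
by induction the coefficient of its first entry is almost surely nonzero, so the determinant is
a nonzero linear functional of the first row. -/
theorem ae_det_ne_zero_of_forall_ae_dotProduct_ne_zero {X : Type*} [MeasurableSpace X] {n : ℕ}
    (ν : Fin n → Measure X) [∀ i, SigmaFinite (ν i)] (f : Fin n → X → Fin n → ℂ)
    (hf : ∀ i, Measurable (f i))
    (h : ∀ i (c : Fin n → ℂ), c ≠ 0 → ∀ᵐ x ∂ν i, c ⬝ᵥ f i x ≠ 0) :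
    ∀ᵐ x ∂Measure.pi ν, (Matrix.of fun i => f i (x i)).det ≠ 0 := by
  induction n with
  | zero => exact Filter.Eventually.of_forall fun x => by simp
  | succ n ih =>
    have hf' : ∀ i j, Measurable fun x => f i x j := fun i j => (measurable_pi_apply j).comp (hf i)
    have hIH := ih (fun i => ν i.succ) (fun i x j => f i.succ x j.succ)
      (fun i => measurable_pi_lambda _ fun j => hf' _ _) (fun i c hc => by
        have hc' : (Fin.cons 0 c : Fin (n + 1) → ℂ) ≠ 0 := fun h0 => hc <| by
          ext j
          simpa using congrFun h0 j.succ
        filter_upwards [h i.succ _ hc'] with x hx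
        simpa [dotProduct, Fin.sum_univ_succ] using hx)
    let C : (Fin n → X) → Fin (n + 1) → ℂ := fun y j =>
      (-1) ^ (j : ℕ) * (Matrix.of fun i l => f (Fin.succ i) (y i) (j.succAbove l)).det
    have hC : ∀ j, Measurable fun y => C y j := fun j =>
      (measurable_det fun i l => (hf' _ _).comp (measurable_pi_apply i)).const_mul _
    have hmeas : MeasurableSet {z : X × (Fin n → X) | C z.2 ⬝ᵥ f 0 z.1 ≠ 0} := by
      have : Measurable fun z : X × (Fin n → X) => C z.2 ⬝ᵥ f 0 z.1 :=
        Finset.measurable_sum _ fun j _ =>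
          ((hC j).comp measurable_snd).mul ((hf' 0 j).comp measurable_fst)
      exact (this (measurableSet_singleton 0)).compl
    have hprod : ∀ᵐ z ∂(ν 0).prod (Measure.pi fun i : Fin n => ν i.succ),
        C z.2 ⬝ᵥ f 0 z.1 ≠ 0 := by
      rw [Measure.ae_prod_iff_ae_ae hmeas,
        Measure.ae_ae_comm (p := fun x y => C y ⬝ᵥ f 0 x ≠ 0) hmeas]
      filter_upwards [hIH] with y hy
      refine h 0 _ fun h0 => hy ?_
      have := congrFun h0 0
      simpa [C] using this
    have hmp := (measurePreserving_piFinSuccAbove ν 0).quasiMeasurePreserving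
    simp only [Fin.succAbove_zero] at hmp
    filter_upwards [hmp.ae hprod] with x hx
    rw [Matrix.det_succ_row_zero]
    convert! hx using 1
    rw [dotProduct]
    refine Finset.sum_congr rfl fun j _ => ?_
    change (-1) ^ (j : ℕ) * f 0 (x 0) j * _ = (-1) ^ (j : ℕ) * _ * f 0 (x 0) j
    rw [mul_right_comm]
    rfl

theorem countable_setOf_exp_neg_I_mul_eq (v : ℂ) :
    {x : ℝ | Complex.exp (-(Complex.I * x)) = v}.Countable := by
  by_cases hne : ∃ x₀ : ℝ, Complex.exp (-(Complex.I * x₀)) = v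
  · obtain ⟨x₀, hx₀⟩ := hne
    refine (Set.countable_range fun n : ℤ => x₀ - n * (2 * Real.pi)).mono fun x hx => ?_
    obtain ⟨n, hn⟩ := Complex.exp_eq_exp_iff_exists_int.1 (Eq.trans hx hx₀.symm)
    refine ⟨n, ?_⟩
    have h1 : (x : ℂ) = x₀ - n * (2 * Real.pi) := by
      linear_combination Complex.I * hn + (x - x₀ + n * (2 * Real.pi)) * Complex.I_sq
    exact_mod_cast h1.symm
  · convert Set.countable_empty (α := ℝ)
    ext x
    simpa using fun hx => hne ⟨x, hx⟩

/-- A nontrivial linear combination of independent unit phasors with nonatomic phases almost surely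
does not vanish. -/
theorem ae_sum_exp_neg_I_mul_ne_zero {N : ℕ} (ν : Fin N → Measure ℝ) [∀ n, SigmaFinite (ν n)]
    [∀ n, NullSingletonClass (ν n)] {d : Fin N → ℂ} (hd : d ≠ 0) :
    ∀ᵐ φ ∂Measure.pi ν, ∑ n, Complex.exp (-(Complex.I * (φ n : ℂ))) * d n ≠ 0 := by
  obtain ⟨n₀, hn₀⟩ := Function.ne_iff.1 hd
  obtain _ | N := N
  · exact n₀.elim0
  have hmeas : MeasurableSet {z : ℝ × (Fin N → ℝ) | Complex.exp (-(Complex.I * z.1)) * d n₀ +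
      ∑ n, Complex.exp (-(Complex.I * (z.2 n : ℂ))) * d (n₀.succAbove n) ≠ 0} := by
    refine ((?_ : Measurable _) (measurableSet_singleton 0)).compl
    fun_prop
  have hprod : ∀ᵐ z ∂(ν n₀).prod (Measure.pi fun n => ν (n₀.succAbove n)),
      Complex.exp (-(Complex.I * z.1)) * d n₀ +
        ∑ n, Complex.exp (-(Complex.I * (z.2 n : ℂ))) * d (n₀.succAbove n) ≠ 0 := by
    rw [Measure.ae_prod_iff_ae_ae hmeas,
      Measure.ae_ae_comm (p := fun (x : ℝ) (y : Fin N → ℝ) =>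
        Complex.exp (-(Complex.I * x)) * d n₀ +
          ∑ n, Complex.exp (-(Complex.I * (y n : ℂ))) * d (n₀.succAbove n) ≠ 0) hmeas]
    refine Filter.Eventually.of_forall fun y => ?_
    filter_upwards [(countable_setOf_exp_neg_I_mul_eq
      (-(∑ n, Complex.exp (-(Complex.I * (y n : ℂ))) * d (n₀.succAbove n)) / d n₀)).ae_notMem
        (ν n₀)] with x hx h0
    exact hx <| (eq_div_iff hn₀).2 (eq_neg_of_add_eq_zero_left h0)
  filter_upwards [(measurePreserving_piFinSuccAbove ν n₀).quasiMeasurePreserving.ae hprod] with φ hφ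
  rw [Fin.sum_univ_succAbove _ n₀]
  exact hφ

/-- Random phase-only combining of a matrix of full column rank with as many outputs as columns
almost surely gives a nonsingular matrix. -/
theorem ae_det_phase_mul_ne_zero {N k : ℕ} (ν : Fin k → Fin N → Measure ℝ)
    [∀ i n, IsProbabilityMeasure (ν i n)] [∀ i n, NullSingletonClass (ν i n)]
    {B : Matrix (Fin N) (Fin k) ℂ} (hB : LinearIndependent ℂ B.col) :
    ∀ᵐ φ ∂Measure.pi fun i => Measure.pi (ν i),
      ((combiner φ)ᴴ * B).det ≠ 0 := by
  have key := ae_det_ne_zero_of_forall_ae_dotProduct_ne_zero (fun i => Measure.pi (ν i))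
    (fun _ φ j => ∑ n, Complex.exp (-(Complex.I * (φ n : ℂ))) * B n j)
    (fun i => measurable_pi_lambda _ fun j => by fun_prop) (fun i c hc => by
      have hd : B *ᵥ c ≠ 0 := fun h0 =>
        hc (Matrix.mulVec_injective_iff.2 hB (h0.trans (Matrix.mulVec_zero B).symm))
      filter_upwards [ae_sum_exp_neg_I_mul_ne_zero (ν i) hd] with φ hφ
      convert! hφ using 1
      simp only [dotProduct, Matrix.mulVec, Finset.mul_sum]
      rw [Finset.sum_comm]
      exact Finset.sum_congr rfl fun n _ => Finset.sum_congr rfl fun j _ => by ring)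
  filter_upwards [key] with φ hφ
  convert! hφ using 2
  ext i j
  simp [Matrix.mul_apply, combiner, ← Complex.exp_conj]

/-! ### Linear independence of spherical wavefronts -/

/-- A trigonometric sum with distinct real frequencies that tends to zero at infinity is trivial:
sampled along `x, x + h, x + 2h, …` it is the image of the vector of its terms under a fixed
invertible Vandermonde matrix, so every single term tends to zero. -/
theorem eq_zero_of_tendsto_sum_exp {n : ℕ} {β : Fin n → ℝ} (hβ : Function.Injective β)
    {c : Fin n → ℂ}
    (h : Filter.Tendsto (fun x : ℝ => ∑ j, c j * Complex.exp (-(Complex.I * (β j * x : ℝ))))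
      Filter.atTop (nhds 0)) : c = 0 := by
  -- a sampling step too small for aliasing
  obtain ⟨δ, hδ, hδβ⟩ : ∃ δ : ℝ, 0 < δ ∧ ∀ j, |β j| * δ < Real.pi := by
    have hS : 0 ≤ ∑ j, |β j| := Finset.sum_nonneg fun _ _ => abs_nonneg _
    refine ⟨Real.pi / (∑ j, |β j| + 1), by positivity, fun j => ?_⟩
    have h1 : |β j| ≤ ∑ j, |β j| :=
      Finset.single_le_sum (f := fun j => |β j|) (fun _ _ => abs_nonneg _) (Finset.mem_univ j)
    rw [mul_div_assoc', div_lt_iff₀ (by positivity), mul_comm]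
    exact mul_lt_mul_of_pos_left (by linarith) Real.pi_pos
  let z : Fin n → ℂ := fun j => Complex.exp (-(Complex.I * (β j * δ : ℝ)))
  have hz : Function.Injective z := by
    intro i j hij
    obtain ⟨m, hm⟩ := Complex.exp_eq_exp_iff_exists_int.1 hij
    have h1 : ((β i * δ : ℝ) : ℂ) = ((β j * δ - m * (2 * Real.pi) : ℝ) : ℂ) := by
      push_cast at hm ⊢
      linear_combination Complex.I * hm + (β i * δ - β j * δ + m * (2 * Real.pi)) * Complex.I_sq
    have h2 : β i * δ = β j * δ - m * (2 * Real.pi) := by exact_mod_cast h1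
    have hb : ∀ j, |β j * δ| < Real.pi := fun j => by
      rw [abs_mul, abs_of_pos hδ]
      exact hδβ j
    have hi := abs_lt.1 (hb i)
    have hj := abs_lt.1 (hb j)
    have hm0 : m = 0 := by
      have h3 : (m : ℝ) < 1 := by
        by_contra! h4
        nlinarith [Real.pi_pos]
      have h4 : (-1 : ℝ) < m := by
        by_contra! h4
        nlinarith [Real.pi_pos]
      have h5 : m < 1 := by exact_mod_cast h3
      have h6 : -1 < m := by exact_mod_cast h4
      omega
    rw [hm0] at h2
    exact hβ (mul_right_cancel₀ hδ.ne' (by simpa using h2))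
  have hV : IsUnit (Matrix.vandermonde z).det :=
    isUnit_iff_ne_zero.2 (Matrix.det_vandermonde_ne_zero_iff.2 hz)
  let u : ℝ → Fin n → ℂ := fun x j => c j * Complex.exp (-(Complex.I * (β j * x : ℝ)))
  have hg : Filter.Tendsto (fun x => u x ᵥ* Matrix.vandermonde z) Filter.atTop (nhds 0) := by
    refine tendsto_pi_nhds.2 fun i => ?_
    have h1 := h.comp (Filter.tendsto_atTop_add_const_right Filter.atTop ((i : ℝ) * δ)
      Filter.tendsto_id)
    refine h1.congr fun x => ?_
    simp only [Function.comp_apply, id, Matrix.vecMul, dotProduct, u, Matrix.vandermonde_apply, z]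
    refine Finset.sum_congr rfl fun j _ => ?_
    rw [mul_assoc, ← Complex.exp_nat_mul, ← Complex.exp_add]
    congr 2
    push_cast
    ring
  have hu : Filter.Tendsto u Filter.atTop (nhds 0) := by
    have hcont : Continuous fun w : Fin n → ℂ => w ᵥ* (Matrix.vandermonde z)⁻¹ :=
      continuous_id.matrix_vecMul continuous_const
    have h1 := (hcont.tendsto 0).comp hg
    rw [Matrix.zero_vecMul] at h1
    refine h1.congr fun x => ?_
    simp [Matrix.vecMul_vecMul, Matrix.mul_nonsing_inv _ hV]
  ext j
  have h1 := ((tendsto_pi_nhds.1 hu) j).norm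
  have h2 : (fun x => ‖u x j‖) = fun _ => ‖c j‖ := by
    ext x
    have : -(Complex.I * ((β j * x : ℝ) : ℂ)) = ((-(β j * x) : ℝ) : ℂ) * Complex.I := by
      push_cast; ring
    simp only [u]
    rw [norm_mul, this, Complex.norm_exp_ofReal_mul_I, mul_one]
  rw [h2, tendsto_const_nhds_iff] at h1
  simpa using h1

theorem tendsto_sqrt_add_mul_sq_sub {a b : ℝ} (ha : 0 ≤ a) (hb : 0 ≤ b) :
    ∃ e : ℝ, Filter.Tendsto (fun x : ℝ => √(a + b * x ^ 2) - √b * x) Filter.atTop (nhds e) := by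
  obtain rfl | hb := hb.eq_or_lt
  · exact ⟨√a, by simp⟩
  refine ⟨0, ?_⟩
  have hsb := Real.sqrt_pos.2 hb
  have hlim : Filter.Tendsto (fun x : ℝ => a / (√b * x)) Filter.atTop (nhds 0) :=
    tendsto_const_nhds.div_atTop (Filter.tendsto_id.const_mul_atTop hsb)
  refine squeeze_zero' ?_ ?_ hlim
  · filter_upwards [Filter.eventually_gt_atTop 0] with x hx
    rw [sub_nonneg]
    refine Real.le_sqrt_of_sq_le ?_
    rw [mul_pow, Real.sq_sqrt hb.le]
    linarith
  · filter_upwards [Filter.eventually_gt_atTop 0] with x hx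
    have hpos : 0 < √b * x := by positivity
    rw [le_div_iff₀ hpos]
    have h1 : √(a + b * x ^ 2) ^ 2 = a + (√b * x) ^ 2 := by
      rw [Real.sq_sqrt (by positivity), mul_pow, Real.sq_sqrt hb.le]
    have h2 : √b * x ≤ √(a + b * x ^ 2) := by
      refine Real.le_sqrt_of_sq_le ?_
      rw [mul_pow, Real.sq_sqrt hb.le]
      linarith
    nlinarith

/-- Combination of the spherical phase profiles of an array as a function of `s = sin θ`, continued
to all real `s`, with wave number `κ`, antenna spacing `d`, and distance `r` to the source. -/
noncomputable def wavefrontSum {n : ℕ} (κ d r : ℝ) (c : Fin n → ℂ) (s : ℝ) : ℂ :=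
  ∑ j : Fin n, c j * Complex.exp (-(Complex.I *
    ((κ * (√(r ^ 2 + (j : ℝ) ^ 2 * d ^ 2 - 2 * r * j * d * s) - r) : ℝ) : ℂ)))

theorem analyticOnNhd_wavefrontSum {n : ℕ} {κ d r : ℝ} (hd : 0 < d) (hr : 0 < r) (c : Fin n → ℂ) :
    AnalyticOnNhd ℝ (wavefrontSum κ d r c) (Set.Iio 1) := by
  intro s hs
  refine ContDiffAt.analyticAt ?_
  unfold wavefrontSum
  refine ContDiffAt.sum fun j _ => contDiffAt_const.mul (ContDiffAt.cexp ?_)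
  have hpos : r ^ 2 + (j : ℝ) ^ 2 * d ^ 2 - 2 * r * j * d * s ≠ 0 := by
    obtain hj | hj := (Nat.cast_nonneg (α := ℝ) (j : ℕ)).eq_or_lt
    · rw [← hj]
      simpa using hr.ne'
    · have h1 : 0 < 2 * r * j * d * (1 - s) := by
        have : 0 < 1 - s := sub_pos.2 hs
        positivity
      nlinarith [sq_nonneg (r - j * d)]
  have h1 : ContDiffAt ℝ ⊤ (fun s => κ * (√(r ^ 2 + (j : ℝ) ^ 2 * d ^ 2 - 2 * r * j * d * s) - r))
      s := by
    refine contDiffAt_const.mul (ContDiffAt.sub (ContDiffAt.sqrt ?_ hpos) contDiffAt_const)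
    fun_prop
  exact (contDiffAt_const.mul (Complex.ofRealCLM.contDiff.contDiffAt.comp s h1)).neg

/-- The continued wavefronts are linearly independent: as `s = -x² → -∞` the phase of the `j`-th
one is `κ √(2 r j d) x` up to a convergent term, and these frequencies are distinct. -/
theorem eq_zero_of_wavefrontSum_eqOn_zero {n : ℕ} {κ d r : ℝ} (hκ : 0 < κ) (hd : 0 < d) (hr : 0 < r)
    {c : Fin n → ℂ} (h : Set.EqOn (wavefrontSum κ d r c) 0 (Set.Iio 1)) : c = 0 := by
  choose e he using fun j : Fin n => tendsto_sqrt_add_mul_sq_sub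
    (a := r ^ 2 + (j : ℝ) ^ 2 * d ^ 2) (b := 2 * r * j * d) (by positivity) (by positivity)
  let β : Fin n → ℝ := fun j => κ * √(2 * r * j * d)
  have hβ : Function.Injective β := by
    intro i j hij
    have h1 := mul_left_cancel₀ hκ.ne' hij
    rw [Real.sqrt_inj (by positivity) (by positivity)] at h1
    have h2 : (i : ℝ) = j := by
      have : 2 * r * d ≠ 0 := by positivity
      refine mul_left_cancel₀ this ?_
      linarith
    exact Fin.ext (by exact_mod_cast h2)
  let γ : ℝ → ℂ := fun y => Complex.exp (-(Complex.I * ((κ * (y - r) : ℝ) : ℂ)))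
  have hγ : Continuous γ := by fun_prop
  have hγ0 : ∀ y, γ y ≠ 0 := fun y => Complex.exp_ne_zero _
  have hc : (fun j => c j * γ (e j)) = 0 := by
    refine eq_zero_of_tendsto_sum_exp hβ ?_
    have hterm : ∀ j : Fin n, Filter.Tendsto (fun x : ℝ => c j *
        ((γ (e j) - γ (√(r ^ 2 + (j : ℝ) ^ 2 * d ^ 2 + 2 * r * j * d * x ^ 2) -
          √(2 * r * j * d) * x)) * Complex.exp (-(Complex.I * (β j * x : ℝ)))))
        Filter.atTop (nhds 0) := by
      intro j
      have h1 : Filter.Tendsto (fun x : ℝ => γ (e j) - γ (√(r ^ 2 + (j : ℝ) ^ 2 * d ^ 2 +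
          2 * r * j * d * x ^ 2) - √(2 * r * j * d) * x)) Filter.atTop (nhds 0) := by
        have := ((hγ.tendsto (e j)).comp (he j)).const_sub (γ (e j))
        rwa [sub_self] at this
      have h2 : Filter.IsBoundedUnder (· ≤ ·) Filter.atTop
          (norm ∘ fun x : ℝ => Complex.exp (-(Complex.I * (β j * x : ℝ)))) := by
        refine Filter.isBoundedUnder_of ⟨1, fun x => ?_⟩
        have : -(Complex.I * ((β j * x : ℝ) : ℂ)) = ((-(β j * x) : ℝ) : ℂ) * Complex.I := by
          push_cast; ring
        rw [Function.comp_apply, this, Complex.norm_exp_ofReal_mul_I]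
      simpa using (h1.zero_mul_isBoundedUnder_le h2).const_mul (c j)
    have hsum := tendsto_finsetSum Finset.univ fun j _ => hterm j
    rw [Finset.sum_const_zero] at hsum
    refine hsum.congr fun x => ?_
    have hx : wavefrontSum κ d r c (-x ^ 2) = 0 := h (by
      simp only [Set.mem_Iio]
      nlinarith [sq_nonneg x])
    rw [← add_zero (Finset.sum _ _), ← hx, wavefrontSum, ← Finset.sum_add_distrib]
    refine Finset.sum_congr rfl fun j _ => ?_
    have h1 : Complex.exp (-(Complex.I * ((κ * (√(r ^ 2 + (j : ℝ) ^ 2 * d ^ 2 -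
        2 * r * j * d * -x ^ 2) - r) : ℝ) : ℂ))) =
        γ (√(r ^ 2 + (j : ℝ) ^ 2 * d ^ 2 + 2 * r * j * d * x ^ 2) - √(2 * r * j * d) * x) *
          Complex.exp (-(Complex.I * (β j * x : ℝ))) := by
      rw [← Complex.exp_add, show r ^ 2 + (j : ℝ) ^ 2 * d ^ 2 - 2 * r * j * d * -x ^ 2 =
        r ^ 2 + (j : ℝ) ^ 2 * d ^ 2 + 2 * r * j * d * x ^ 2 by ring]
      congr 1
      simp only [β]
      push_cast
      ring
    rw [h1]
    ring
  ext j
  simpa [hγ0] using congrFun hc j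

theorem countable_preimage_sin {S : Set ℝ} (hS : S.Countable) : (Real.sin ⁻¹' S).Countable := by
  rw [← Set.biUnion_preimage_singleton]
  refine hS.biUnion fun s _ => ?_
  by_cases hne : ∃ x₀ : ℝ, Real.sin x₀ = s
  · obtain ⟨x₀, rfl⟩ := hne
    refine ((Set.countable_range fun k : ℤ => 2 * k * Real.pi + x₀).union
      (Set.countable_range fun k : ℤ => (2 * k + 1) * Real.pi - x₀)).mono fun x hx => ?_
    obtain ⟨k, hk | hk⟩ := Real.sin_eq_sin_iff.1 (Eq.symm hx)
    · exact Or.inl ⟨k, hk.symm⟩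
    · exact Or.inr ⟨k, hk.symm⟩
  · convert Set.countable_empty (α := ℝ)
    ext x
    simpa using fun hx => hne ⟨x, hx⟩

theorem ae_wavefrontSum_sin_ne_zero {n : ℕ} {κ d r : ℝ} (hκ : 0 < κ) (hd : 0 < d) (hr : 0 < r)
    {c : Fin n → ℂ} (hc : c ≠ 0) : ∀ᵐ θ : ℝ, wavefrontSum κ d r c (Real.sin θ) ≠ 0 := by
  have han := analyticOnNhd_wavefrontSum (κ := κ) hd hr c
  obtain h0 | hne := han.eqOn_zero_or_eventually_ne_zero_of_preconnected isPreconnected_Iio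
  · exact absurd (eq_zero_of_wavefrontSum_eqOn_zero hκ hd hr h0) hc
  have hcount : ({s | wavefrontSum κ d r c s ≠ 0}ᶜ ∩ Set.Iio 1).Countable :=
    (HereditarilyLindelofSpace.isLindelof _).countable_of_isDiscrete
      (isDiscrete_of_codiscreteWithin (by simpa using! hne))
  -- the branch point `sin θ = 1` is not covered by analyticity
  filter_upwards [(countable_preimage_sin (hcount.union (Set.countable_singleton 1))).ae_notMem
    volume] with θ hθ h0
  refine hθ ?_
  obtain h1 | h1 := (Real.sin_le_one θ).eq_or_lt
  · exact Or.inr h1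
  · exact Or.inl ⟨by simpa using h0, h1⟩

theorem measurable_steeringVec (N : ℕ) (lam : ℝ) (n : Fin N) :
    Measurable fun p : ℝ × ℝ => steeringVec N lam p.1 p.2 n := by
  unfold steeringVec antennaDist
  fun_prop

/-- No nontrivial combination of the first `K` antenna outputs vanishes on a set of source positions
of positive measure. The absolute value extends the claim to all real `r` apart from `0`. -/
theorem ae_dotProduct_steeringVec_ne_zero {N K : ℕ} (hKN : K ≤ N) {lam : ℝ} (hlam : 0 < lam)
    {c : Fin K → ℂ} (hc : c ≠ 0) :
    ∀ᵐ p : ℝ × ℝ, c ⬝ᵥ (fun k => steeringVec N lam p.1 |p.2| (Fin.castLE hKN k)) ≠ 0 := by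
  have hmeas : MeasurableSet {p : ℝ × ℝ |
      c ⬝ᵥ (fun k => steeringVec N lam p.1 |p.2| (Fin.castLE hKN k)) ≠ 0} := by
    have : Measurable fun p : ℝ × ℝ =>
        c ⬝ᵥ (fun k => steeringVec N lam p.1 |p.2| (Fin.castLE hKN k)) :=
      Finset.measurable_sum _ fun k _ => ((measurable_steeringVec N lam _).comp
        (f := fun p : ℝ × ℝ => (p.1, |p.2|)) (by fun_prop)).const_mul _
    exact (this (measurableSet_singleton 0)).compl
  rw [Measure.volume_eq_prod, Measure.ae_prod_iff_ae_ae hmeas,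
    Measure.ae_ae_comm (p := fun θ r =>
      c ⬝ᵥ (fun k => steeringVec N lam θ |r| (Fin.castLE hKN k)) ≠ 0) hmeas]
  filter_upwards [(Set.countable_singleton (0 : ℝ)).ae_notMem volume] with r hr
  filter_upwards [ae_wavefrontSum_sin_ne_zero (κ := 2 * Real.pi / lam) (d := lam / 2)
    (by positivity) (by positivity) (abs_pos.2 hr) hc] with θ hθ
  have hN : ((1 / √(N : ℝ) : ℝ) : ℂ) ≠ 0 := by
    obtain ⟨k, -⟩ := Function.ne_iff.1 hc
    have : 0 < N := k.pos.trans_le hKN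
    have h1 : (0 : ℝ) < 1 / √(N : ℝ) := by positivity
    exact_mod_cast h1.ne'
  convert! mul_ne_zero hN hθ using 1
  rw [wavefrontSum, dotProduct, Finset.mul_sum]
  refine Finset.sum_congr rfl fun k _ => ?_
  rw [steeringVec, antennaDist, Fin.val_castLE]
  ring

/-- Sources in general position have linearly independent steering vectors. -/
theorem ae_rank_steeringMat_eq {N K : ℕ} (hKN : K ≤ N) {fc c : ℝ} (hfc : 0 < fc) (hc : 0 < c) :
    ∀ᵐ p : (Fin K → ℝ) × (Fin K → ℝ), (∀ k, 0 < p.2 k) →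
      (steeringMat N fc c p.1 p.2).rank = K := by
  have hmeas : Measurable fun p : ℝ × ℝ => fun k : Fin K =>
      steeringVec N (c / fc) p.1 |p.2| (Fin.castLE hKN k) :=
    measurable_pi_lambda _ fun k => (measurable_steeringVec N _ _).comp
        (f := fun p : ℝ × ℝ => (p.1, |p.2|)) (by fun_prop)
  have key := ae_det_ne_zero_of_forall_ae_dotProduct_ne_zero
    (fun _ : Fin K => (volume : Measure (ℝ × ℝ))) (fun _ p k =>
      steeringVec N (c / fc) p.1 |p.2| (Fin.castLE hKN k)) (fun _ => hmeas)
    (fun _ a ha => ae_dotProduct_steeringVec_ne_zero hKN (div_pos hc hfc) ha)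
  have hmp := (volume_measurePreserving_arrowProdEquivProdArrow ℝ ℝ (Fin K)).symm
  filter_upwards [hmp.quasiMeasurePreserving.ae key] with p hp hpos
  rw [rank_eq_card_iff_linearIndependent_col]
  refine LinearIndependent.of_comp (R := ℂ) (LinearMap.funLeft ℂ ℂ (Fin.castLE hKN)) ?_
  convert! Matrix.linearIndependent_rows_of_det_ne_zero hp using 1
  ext k n
  change steeringVec N (c / fc) (p.1 k) (p.2 k) _ = steeringVec N (c / fc) (p.1 k) |p.2 k| _
  rw [abs_of_pos (hpos k)]

/-! ### Factor matrices of the received tensor -/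

/-- On equally spaced sub-carriers a phase response is a geometric progression. -/
theorem delayResponse_eq (fc Bw : ℝ) (P : ℕ) (τ : ℝ) (p : Fin P) :
    delayResponse fc Bw P τ p = delayResponse fc Bw P τ ⟨0, p.pos⟩ *
      Complex.exp (-(Complex.I * ((2 * Real.pi * (Bw / P * τ) : ℝ) : ℂ))) ^ (p : ℕ) := by
  have hP : (P : ℂ) ≠ 0 := Nat.cast_ne_zero.2 p.pos.ne'
  rw [delayResponse, delayResponse, ← Complex.exp_nat_mul, ← Complex.exp_add]
  congr 1
  simp only [subcarrierFreq]
  push_cast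
  field_simp
  ring

theorem injective_exp_delay {K : ℕ} {Bw : ℝ} (hBw : 0 < Bw) {P : ℕ} (hP : 0 < P) {τ : Fin K → ℝ}
    (hτ : DistinctDelays Bw P τ) : Function.Injective fun k =>
      Complex.exp (-(Complex.I * ((2 * Real.pi * (Bw / P * τ k) : ℝ) : ℂ))) := by
  intro i j hij
  by_contra hne
  obtain ⟨m, hm⟩ := Complex.exp_eq_exp_iff_exists_int.1 hij
  have hP' : (P : ℝ) ≠ 0 := Nat.cast_ne_zero.2 hP.ne'
  refine hτ i j hne (-m) ?_
  have h1 : ((2 * Real.pi * (Bw / P * τ i) : ℝ) : ℂ) =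
      ((2 * Real.pi * (Bw / P * τ j) - m * (2 * Real.pi) : ℝ) : ℂ) := by
    push_cast at hm ⊢
    linear_combination Complex.I * hm + (2 * Real.pi * (Bw / P * τ i) -
      2 * Real.pi * (Bw / P * τ j) + m * (2 * Real.pi)) * Complex.I_sq
  have h2 : 2 * Real.pi * (Bw / P * τ i) = 2 * Real.pi * (Bw / P * τ j) - m * (2 * Real.pi) := by
    exact_mod_cast h1
  have h3 : 2 * Real.pi * (Bw * (τ i - τ j)) = 2 * Real.pi * (-m * P) := by
    field_simp at h2
    linear_combination 2 * Real.pi * h2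
  have h4 := mul_left_cancel₀ (by positivity) h3
  push_cast
  rw [← mul_div_assoc, eq_div_iff hBw.ne', ← h4, mul_comm]

theorem kRank_factorG {K : ℕ} (fc : ℝ) {Bw : ℝ} (hBw : 0 < Bw) {P : ℕ} {τ : Fin K → ℝ}
    (hτ : DistinctDelays Bw P τ) : kRank (factorG fc Bw P τ) = min P K := by
  refine kRank_eq_min fun s hs => ?_
  refine linearIndependent_col_of_det_ne_zero _ (Fin.castLE (min_le_left P K)) s hs ?_
  obtain hk | hk := Nat.eq_zero_or_pos (min P K)
  · have : IsEmpty (Fin (min P K)) := by rw [hk]; infer_instance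
    simp
  have hP : 0 < P := hk.trans_le (min_le_left _ _)
  have hinj := (injective_exp_delay hBw hP hτ).comp (s.orderEmbOfFin hs).injective
  have hmat : ((factorG fc Bw P τ).submatrix (Fin.castLE (min_le_left P K))
      fun j => s.orderEmbOfFin hs j) = (Matrix.diagonal (fun j =>
        delayResponse fc Bw P (τ (s.orderEmbOfFin hs j)) ⟨0, hP⟩) * Matrix.vandermonde
        ((fun k => Complex.exp (-(Complex.I * ((2 * Real.pi * (Bw / P * τ k) : ℝ) : ℂ)))) ∘
          s.orderEmbOfFin hs))ᵀ := by
    ext i j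
    rw [Matrix.transpose_apply, Matrix.diagonal_mul, Matrix.vandermonde_apply]
    exact delayResponse_eq fc Bw P _ _
  rw [hmat, Matrix.det_transpose, Matrix.det_mul, Matrix.det_diagonal]
  exact mul_ne_zero (Finset.prod_ne_zero_iff.2 fun j _ => Complex.exp_ne_zero _)
    (Matrix.det_vandermonde_ne_zero_iff.2 hinj)

theorem kRank_factorA {N M K : ℕ} {fc c : ℝ} {W : Matrix (Fin N) (Fin M) ℂ} {α : Fin K → ℂ}
    {θ r : Fin K → ℝ} (hα : ∀ k, α k ≠ 0)
    (hW : ∀ (s : Finset (Fin K)) (hs : s.card = min M K),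
      ((Wᴴ * steeringMat N fc c θ r).submatrix (Fin.castLE (min_le_left M K))
        fun j => s.orderEmbOfFin hs j).det ≠ 0) :
    kRank (factorA fc c W α θ r) = min M K := by
  refine kRank_eq_min fun s hs => ?_
  refine linearIndependent_col_of_det_ne_zero _ (Fin.castLE (min_le_left M K)) s hs ?_
  have hmat : ((factorA fc c W α θ r).submatrix (Fin.castLE (min_le_left M K))
      fun j => s.orderEmbOfFin hs j) =
        ((Wᴴ * steeringMat N fc c θ r).submatrix (Fin.castLE (min_le_left M K))
          fun j => s.orderEmbOfFin hs j) * Matrix.diagonal (fun j => α (s.orderEmbOfFin hs j)) := by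
    ext i j
    simp [factorA, Matrix.mul_diagonal]
  rw [hmat, Matrix.det_mul, Matrix.det_diagonal]
  exact mul_ne_zero (hW s hs) (Finset.prod_ne_zero_iff.2 fun j _ => hα _)

theorem receivedTensor_eq_cpTensor {N M P T K : ℕ} (fc Bw c : ℝ) (W : Matrix (Fin N) (Fin M) ℂ)
    (α : Fin K → ℂ) (τ θ r : Fin K → ℝ) (S : Matrix (Fin T) (Fin K) ℂ) :
    receivedTensor (P := P) fc Bw c W α τ θ r S =
      cpTensor (factorG fc Bw P τ) (factorA fc c W α θ r) S := by
  ext p m t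
  simp only [receivedTensor, cpTensor, factorG, factorA, Matrix.of_apply, dotProduct_sum,
    dotProduct_smul, losChannel, smul_eq_mul, Matrix.mul_diagonal]
  refine Finset.sum_congr rfl fun k _ => ?_
  have h1 : (Wᴴ * steeringMat N fc c θ r) m k =
      star (W.col m) ⬝ᵥ steeringVec N (c / fc) (θ k) (r k) := rfl
  rw [h1]
  ring

/-- The uniqueness analysis holds once all maximal minors in the leading rows of the combined array
response matrix are nonzero. -/
theorem losUniqueness_of_det_ne_zero {N M K : ℕ} {fc Bw c : ℝ} (hBw : 0 < Bw)
    {W : Matrix (Fin N) (Fin M) ℂ} {θ r : Fin K → ℝ}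
    (hW : ∀ (s : Finset (Fin K)) (hs : s.card = min M K),
      ((Wᴴ * steeringMat N fc c θ r).submatrix (Fin.castLE (min_le_left M K))
        fun j => s.orderEmbOfFin hs j).det ≠ 0) :
    LosUniqueness fc Bw c W θ r := by
  intro P τ α hτ hα
  have hG := kRank_factorG fc hBw hτ
  have hA := kRank_factorA hα hW
  refine ⟨hG, hA, fun T S hP hM hK _ hS => ?_⟩
  rw [min_eq_right hP] at hG
  rw [min_eq_right hM] at hA
  have hS0 := ne_zero_of_pairwise_linearIndependent hK hS
  have hGi := linearIndependent_col_of_kRank_eq hG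
  have hAi := linearIndependent_col_of_kRank_eq hA
  refine ⟨hG, hA, ?_, ?_, ?_⟩
  · have := two_le_kRank hK hS
    omega
  · rw [receivedTensor_eq_cpTensor]
    exact hasTensorRank_of_linearIndependent hGi hAi hS0
  · rw [receivedTensor_eq_cpTensor]
    exact isEssentiallyUniqueCPD_of_linearIndependent hGi hAi hS0 hS

/-! ### Random combiners and random placements -/

theorem map_phases_eq_pi {M N : ℕ} {Ω : Type*} [MeasurableSpace Ω] {μ : Measure Ω}
    [IsProbabilityMeasure μ] {Φ : Fin M → Fin N → Ω → ℝ} (hΦm : ∀ m n, Measurable (Φ m n))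
    (hΦi : iIndepFun (fun mn : Fin M × Fin N => Φ mn.1 mn.2) μ) :
    μ.map (fun ω m n => Φ m n ω) = Measure.pi fun m => Measure.pi fun n => μ.map (Φ m n) := by
  have : ∀ m n, IsProbabilityMeasure (μ.map (Φ m n)) := fun m n =>
    Measure.isProbabilityMeasure_map (hΦm m n).aemeasurable
  have h1 := (iIndepFun_iff_map_fun_eq_pi_map (fun mn : Fin M × Fin N =>
    (hΦm mn.1 mn.2).aemeasurable)).1 hΦi
  have h2 := Measure.infinitePi_map_curry (fun m n => μ.map (Φ m n))
  simp only [Measure.infinitePi_eq_pi] at h2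
  rw [← h2, ← h1]
  exact (Measure.map_map (g := MeasurableEquiv.curry (Fin M) (Fin N) ℝ)
    (f := fun ω (mn : Fin M × Fin N) => Φ mn.1 mn.2 ω) (MeasurableEquiv.measurable _)
    (measurable_pi_lambda _ fun mn => hΦm mn.1 mn.2)).symm

theorem measurable_steeringMat {N K : ℕ} (fc c : ℝ) (n : Fin N) (k : Fin K) :
    Measurable fun p : (Fin K → ℝ) × (Fin K → ℝ) => steeringMat N fc c p.1 p.2 n k :=
  (measurable_steeringVec N (c / fc) n).comp
    (f := fun p : (Fin K → ℝ) × (Fin K → ℝ) => (p.1 k, p.2 k)) (by fun_prop)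

theorem measurable_conjTranspose_mul_apply {X : Type*} [MeasurableSpace X] {l m n : ℕ}
    {A : X → Matrix (Fin l) (Fin m) ℂ} {B : X → Matrix (Fin l) (Fin n) ℂ}
    (hA : ∀ i j, Measurable fun x => A x i j) (hB : ∀ i j, Measurable fun x => B x i j)
    (i : Fin m) (j : Fin n) : Measurable fun x => ((A x)ᴴ * B x) i j := by
  simp only [Matrix.mul_apply, Matrix.conjTranspose_apply]
  exact Finset.measurable_sum _ fun k _ =>
    (Complex.continuous_conj.measurable.comp (hA k i)).mul (hB k j)

/-- A single square minor of the combined array response matrix almost surely does not vanish when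
the array response matrix has full column rank. -/
theorem ae_det_combiner_mul_submatrix_ne_zero {N K k : ℕ} (fc c : ℝ) {Ω : Type*}
    [MeasurableSpace Ω] {μ : Measure Ω} [IsProbabilityMeasure μ]
    {Φ : Fin k → Fin N → Ω → ℝ} (hΦm : ∀ m n, Measurable (Φ m n))
    (hΦu : ∀ m n, μ.map (Φ m n) ≪ volume)
    (hΦi : iIndepFun (fun mn : Fin k × Fin N => Φ mn.1 mn.2) μ)
    {p : Ω → (Fin K → ℝ) × (Fin K → ℝ)} (hp : Measurable p)
    (hind : IndepFun p (fun ω m n => Φ m n ω) μ) (e : Fin k ↪ Fin K) :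
    ∀ᵐ ω ∂μ, (steeringMat N fc c (p ω).1 (p ω).2).rank = K →
      ((combiner fun m n => Φ m n ω)ᴴ *
        (steeringMat N fc c (p ω).1 (p ω).2).submatrix id e).det ≠ 0 := by
  have : ∀ m n, IsProbabilityMeasure (μ.map (Φ m n)) := fun m n =>
    Measure.isProbabilityMeasure_map (hΦm m n).aemeasurable
  have : ∀ m n, NullSingletonClass (μ.map (Φ m n)) := fun m n =>
    ⟨fun x => hΦu m n (measure_singleton x)⟩
  have hΦ : Measurable fun ω m n => Φ m n ω :=
    measurable_pi_lambda _ fun m => measurable_pi_lambda _ fun n => hΦm m n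
  have hmeas : MeasurableSet {z : ((Fin K → ℝ) × (Fin K → ℝ)) × (Fin k → Fin N → ℝ) |
      (steeringMat N fc c z.1.1 z.1.2).rank = K →
        ((combiner z.2)ᴴ * (steeringMat N fc c z.1.1 z.1.2).submatrix id e).det ≠ 0} := by
    simp only [rank_eq_card_iff_det_gram_ne_zero]
    have hB : ∀ n j, Measurable fun z : ((Fin K → ℝ) × (Fin K → ℝ)) × (Fin k → Fin N → ℝ) =>
        steeringMat N fc c z.1.1 z.1.2 n j := fun n j =>
      (measurable_steeringMat fc c n j).comp measurable_fst
    have h1 : Measurable fun z : ((Fin K → ℝ) × (Fin K → ℝ)) × (Fin k → Fin N → ℝ) =>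
        ((steeringMat N fc c z.1.1 z.1.2)ᴴ * steeringMat N fc c z.1.1 z.1.2).det :=
      measurable_det (measurable_conjTranspose_mul_apply hB hB)
    have h2 : Measurable fun z : ((Fin K → ℝ) × (Fin K → ℝ)) × (Fin k → Fin N → ℝ) =>
        ((combiner z.2)ᴴ * (steeringMat N fc c z.1.1 z.1.2).submatrix id e).det :=
      measurable_det (measurable_conjTranspose_mul_apply
        (fun n m => by simp only [combiner, Matrix.of_apply]; fun_prop) fun n j => hB n (e j))
    exact (h1 (measurableSet_singleton 0)).compl.imp (h2 (measurableSet_singleton 0)).compl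
  have hlaw : μ.map (fun ω => (p ω, fun m n => Φ m n ω)) =
      (μ.map p).prod (Measure.pi fun m => Measure.pi fun n => μ.map (Φ m n)) := by
    rw [(indepFun_iff_map_prod_eq_prod_map_map hp.aemeasurable hΦ.aemeasurable).1 hind,
      map_phases_eq_pi hΦm hΦi]
  have hae : ∀ᵐ z ∂μ.map (fun ω => (p ω, fun m n => Φ m n ω)),
      (steeringMat N fc c z.1.1 z.1.2).rank = K →
        ((combiner z.2)ᴴ * (steeringMat N fc c z.1.1 z.1.2).submatrix id e).det ≠ 0 := by
    rw [hlaw, Measure.ae_prod_iff_ae_ae hmeas]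
    refine Filter.Eventually.of_forall fun q => ?_
    by_cases hrank : (steeringMat N fc c q.1 q.2).rank = K
    · have hcol := ((rank_eq_card_iff_linearIndependent_col _).1 hrank).comp e e.injective
      filter_upwards [ae_det_phase_mul_ne_zero (fun m n => μ.map (Φ m n))
        (B := (steeringMat N fc c q.1 q.2).submatrix id e) hcol] with φ hφ _ using hφ
    · exact Filter.Eventually.of_forall fun φ h => absurd h hrank
  exact ae_of_ae_map (hp.prodMk hΦ).aemeasurable hae

theorem ae_losUniqueness_of_rank_eq {N M K : ℕ} (fc : ℝ) {Bw : ℝ} (c : ℝ) (hBw : 0 < Bw)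
    {Ω : Type*} [MeasurableSpace Ω] {μ : Measure Ω} [IsProbabilityMeasure μ]
    {Φ : Fin M → Fin N → Ω → ℝ} (hΦm : ∀ m n, Measurable (Φ m n))
    (hΦu : ∀ m n, μ.map (Φ m n) ≪ volume)
    (hΦi : iIndepFun (fun mn : Fin M × Fin N => Φ mn.1 mn.2) μ)
    {θ r : Ω → Fin K → ℝ} (hθ : Measurable θ) (hr : Measurable r)
    (hind : IndepFun (fun ω => (θ ω, r ω)) (fun ω (mn : Fin M × Fin N) => Φ mn.1 mn.2 ω) μ) :
    ∀ᵐ ω ∂μ, (steeringMat N fc c (θ ω) (r ω)).rank = K →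
      LosUniqueness fc Bw c (combiner fun m n => Φ m n ω) (θ ω) (r ω) := by
  have hall : ∀ᵐ ω ∂μ, ∀ (s : Finset (Fin K)) (hs : s.card = min M K),
      (steeringMat N fc c (θ ω) (r ω)).rank = K →
      ((combiner fun m n => Φ (Fin.castLE (min_le_left M K) m) n ω)ᴴ *
        (steeringMat N fc c (θ ω) (r ω)).submatrix id
          (s.orderEmbOfFin hs).toEmbedding).det ≠ 0 := by
    refine ae_all_iff.2 fun s => ae_all_iff.2 fun hs => ?_
    refine ae_det_combiner_mul_submatrix_ne_zero fc c
      (Φ := fun m n => Φ (Fin.castLE (min_le_left M K) m) n) (fun _ _ => hΦm _ _)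
      (fun _ _ => hΦu _ _) ?_ (hθ.prodMk hr) ?_ _
    · exact hΦi.precomp (g := fun mn : Fin (min M K) × Fin N =>
        (Fin.castLE (min_le_left M K) mn.1, mn.2)) ((Fin.castLE_injective _).prodMap
          Function.injective_id)
    · exact hind.comp (φ := id) (ψ := fun f m n => f (Fin.castLE (min_le_left M K) m, n))
        measurable_id (by fun_prop)
  filter_upwards [hall] with ω hω hrank
  refine losUniqueness_of_det_ne_zero hBw fun s hs => ?_
  exact hω s hs hrank

theorem mainTheorem1 {N M K : ℕ} (fc Bw c : ℝ) (hfc : 0 < fc) (hBw : 0 < Bw) (hc : 0 < c)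
    {Ω : Type*} [MeasurableSpace Ω] (μ : Measure Ω) [IsProbabilityMeasure μ]
    -- the phases of the combiner are independent and uniform on `(0, 2π)`
    (Φ : Fin M → Fin N → Ω → ℝ) (hΦm : ∀ m n, Measurable (Φ m n))
    (hΦu : ∀ m n, pdf.IsUniform (Φ m n) (Set.Ioo 0 (2 * Real.pi)) μ volume)
    (hΦi : iIndepFun (fun mn : Fin M × Fin N => Φ mn.1 mn.2) μ)
    -- the users' angles and distances, fixed or random, are independent of the combiner
    (θ r : Ω → Fin K → ℝ) (hθ : Measurable θ) (hr : Measurable r)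
    (hpos : ∀ᵐ ω ∂μ, ∀ k, 0 < r ω k)
    (hind : IndepFun (fun ω => (θ ω, r ω)) (fun ω (mn : Fin M × Fin N) => Φ mn.1 mn.2 ω) μ) :
    -- users placed at random, with a joint density
    (K ≤ N → (μ.map fun ω => (θ ω, r ω)) ≪ volume →
      ∀ᵐ ω ∂μ, (steeringMat N fc c (θ ω) (r ω)).rank = K ∧
        LosUniqueness fc Bw c (combiner fun m n => Φ m n ω) (θ ω) (r ω)) ∧
    -- any placement whose array response matrix has full column rank
    (∀ᵐ ω ∂μ, (steeringMat N fc c (θ ω) (r ω)).rank = K →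
      LosUniqueness fc Bw c (combiner fun m n => Φ m n ω) (θ ω) (r ω)) := by
  have hmain := ae_losUniqueness_of_rank_eq fc c hBw hΦm
    (fun m n => (hΦu m n).absolutelyContinuous) hΦi hθ hr hind
  refine ⟨fun hKN hac => ?_, hmain⟩
  have hrank := ae_of_ae_map (hθ.prodMk hr).aemeasurable
    (hac.ae_le (ae_rank_steeringMat_eq hKN hfc hc))
  filter_upwards [hmain, hrank, hpos] with ω h1 h2 h3
  exact ⟨h2 h3, h1 (h2 h3)⟩
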